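/- Let $p$ be a prime, let $\lambda_1\ge\lambda_2\ge\lambda_3\ge 1$ be integers, and let $G=\mathbb{Z}_{p^{\lambda_1}}\times\mathbb{Z}_{p^{\lambda_2}}\times\mathbb{Z}_{p^{\lambda_3}}$, where $\mathbb{Z}_n$ denotes the cyclic group of order $n$. For $1\le i\le\lambda_1$ let $\mathcal{E}_{p^i}(G)$ be the set of subgroups of $G$ whose exponent equals $p^i$. Then $$ |\mathcal{E}_{p^i}(G)|=\begin{cases} \dfrac{p^{2i-1}\left((i+1)p^4+(i-1)p^3-p^2-(i+2)p-i\right)+3}{(p^2-1)(p-1)}, & 1\le i\le\lambda_3,\\[2ex] \dfrac{(\lambda_3+1)p^{\lambda_3+i}(p^2-1)(p+1)-2p^{2\lambda_3+2}+2}{(p^2-1)(p-1)}, & \lambda_3<i\le\lambda_2,\\[2ex] \dfrac{(\lambda_3+1)p^{\lambda_2+\lambda_3+1}(p^2-1)-p^{2\lambda_3+2}+1}{(p^2-1)(p-1)}, & \lambda_2<i\le\lambda_1. \end{cases} $$ -/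

import Mathlib

/-- The set of all subgroups of exponent `d` of the (additively written) group `G`. -/
def subgroupsOfExponent (G : Type*) [AddCommGroup G] (d : ℕ) : Set (AddSubgroup G) :=
  {H | AddMonoid.exponent H = d}

/-!
The subgroups of `G` of exponent `p^i` are those contained in the `p^i`-torsion of `G` but not in
the `p^(i-1)`-torsion, and both torsion subgroups are products of three cyclic groups. With
`N(a, b, c)` the number of subgroups of `ℤ/p^a × ℤ/p^b × ℤ/p^c`, the number sought is therefore
`N(min l₁ i, min l₂ i, min l₃ i) - N(min l₁ (i-1), min l₂ (i-1), min l₃ (i-1))`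
(`ncard_subgroupsOfExponent_add`).

Goursat's lemma for `A × B` (`AddMonoidHom.relGraph_bijective`) describes a subgroup by its
projection `P` to `A`, its intersection `K` with `B`, and a homomorphism `P → B ⧸ K`. For `A`
cyclic of order `p^(a+1)` and `B` killed by `p^(a+1)` there are `|B ⧸ K|` such homomorphisms with
`P = A`. Hence `N(a+1, b, c) - N(a, b, c)` is `T(b, c)`, the sum of `|B ⧸ K|` over the subgroups
`K` of `B = ℤ/p^b × ℤ/p^c`, as soon as `b, c ≤ a + 1` (`numSubgroups_succ`). As `N` is symmetric,
lowering the coordinates equal to `i` one after another expresses the number sought as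
`T(i, i) + T(i, i-1) + T(i-1, i-1)`, `T(i, l₃) + T(i-1, l₃)` or `T(l₂, l₃)` in the three ranges.

Goursat's lemma applied to `B` itself gives `T(b, c)` as the double sum `indexSum`
(`sum_card_quotient_eq_indexSum`), and two recursions in `b` and `c` evaluate that sum in closed
form (`indexSum_mul`).
-/

noncomputable instance AddSubgroup.fintypeOfFinite {A : Type*} [AddGroup A] [Finite A] :
    Fintype (AddSubgroup A) :=
  Fintype.ofFinite _

/-! ### Goursat's description of the subgroups of a product -/

section Goursat

variable {A B : Type*} [AddCommGroup A] [AddCommGroup B]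

/-- The subgroup of `A × B` that a homomorphism `φ : P → B ⧸ K` defined on a subgroup `P` of `A`
determines: the pairs `(a, b)` with `a ∈ P` and `φ a = b + K`. -/
def AddMonoidHom.relGraph {P : AddSubgroup A} {K : AddSubgroup B} (φ : P →+ B ⧸ K) :
    AddSubgroup (A × B) where
  carrier := {x | ∃ h : x.1 ∈ P, φ ⟨x.1, h⟩ = (x.2 : B ⧸ K)}
  zero_mem' := ⟨P.zero_mem, map_zero φ⟩
  add_mem' := by
    rintro ⟨a, b⟩ ⟨c, d⟩ ⟨h, e⟩ ⟨h', e'⟩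
    refine ⟨P.add_mem h h', ?_⟩
    have := map_add φ ⟨a, h⟩ ⟨c, h'⟩
    simp only at e e'
    rw [e, e'] at this
    exact this
  neg_mem' := by
    rintro ⟨a, b⟩ ⟨h, e⟩
    refine ⟨P.neg_mem h, ?_⟩
    have := map_neg φ ⟨a, h⟩
    simp only at e
    rw [e] at this
    exact this

theorem AddMonoidHom.map_fst_relGraph {P : AddSubgroup A} {K : AddSubgroup B}
    (φ : P →+ B ⧸ K) : φ.relGraph.map (AddMonoidHom.fst A B) = P := by
  ext a
  constructor
  · rintro ⟨x, ⟨h, -⟩, rfl⟩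
    exact h
  · intro h
    obtain ⟨b, hb⟩ := QuotientAddGroup.mk_surjective (φ ⟨a, h⟩)
    exact ⟨(a, b), ⟨h, hb.symm⟩, rfl⟩

theorem AddMonoidHom.comap_inr_relGraph {P : AddSubgroup A} {K : AddSubgroup B}
    (φ : P →+ B ⧸ K) : φ.relGraph.comap (AddMonoidHom.inr A B) = K := by
  ext b
  have h0 : φ ⟨0, P.zero_mem⟩ = 0 := map_zero φ
  constructor
  · rintro ⟨h, e⟩
    exact (QuotientAddGroup.eq_zero_iff b).1 (e.symm.trans h0)
  · intro h
    exact ⟨P.zero_mem, h0.trans ((QuotientAddGroup.eq_zero_iff b).2 h).symm⟩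

theorem AddMonoidHom.relGraph_injective {P : AddSubgroup A} {K : AddSubgroup B} :
    Function.Injective (AddMonoidHom.relGraph : (P →+ B ⧸ K) → AddSubgroup (A × B)) := by
  intro φ ψ h
  ext ⟨a, ha⟩
  obtain ⟨b, hb⟩ := QuotientAddGroup.mk_surjective (φ ⟨a, ha⟩)
  have h1 : (a, b) ∈ φ.relGraph := ⟨ha, hb.symm⟩
  rw [h] at h1
  exact hb.symm.trans h1.2.symm

theorem AddMonoidHom.exists_relGraph_eq (H : AddSubgroup (A × B)) :
    ∃ φ : H.map (AddMonoidHom.fst A B) →+ B ⧸ H.comap (AddMonoidHom.inr A B),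
      φ.relGraph = H := by
  have hex : ∀ a : H.map (AddMonoidHom.fst A B), ∃ b, ((a : A), b) ∈ H := by
    rintro ⟨_, ⟨a, b⟩, h, rfl⟩
    exact ⟨b, h⟩
  choose f hf using hex
  -- The second coordinate is determined by the first one modulo `H ∩ B`.
  have key : ∀ (a : H.map (AddMonoidHom.fst A B)) (b : B), ((a : A), b) ∈ H ↔
      (f a : B ⧸ H.comap (AddMonoidHom.inr A B)) = b := by
    intro a b
    rw [QuotientAddGroup.eq]
    change _ ↔ ((0 : A), -f a + b) ∈ H
    have : ((a : A), b) = ((a : A), f a) + ((0 : A), -f a + b) := by simp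
    rw [this]
    exact H.add_mem_cancel_left (hf a)
  refine ⟨AddMonoidHom.mk' (fun a => (f a : B ⧸ H.comap (AddMonoidHom.inr A B))) ?_, ?_⟩
  · intro a a'
    refine (key (a + a') (f a + f a')).1 ?_
    exact H.add_mem (hf a) (hf a')
  · ext ⟨a, b⟩
    constructor
    · rintro ⟨h, e⟩
      exact (key ⟨a, h⟩ b).2 e
    · intro h
      have ha : a ∈ H.map (AddMonoidHom.fst A B) := ⟨(a, b), h, rfl⟩
      exact ⟨ha, (key ⟨a, ha⟩ b).1 h⟩

/-- A subgroup `H` of `A × B` is the same as a subgroup `P` of `A` (the projection of `H`), a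
subgroup `K` of `B` (the intersection of `H` with `B`) and a homomorphism `P → B ⧸ K`. -/
theorem AddMonoidHom.relGraph_bijective : Function.Bijective
    (fun x : (P : AddSubgroup A) × (K : AddSubgroup B) × (P →+ B ⧸ K) => x.2.2.relGraph) := by
  constructor
  · rintro ⟨P, K, φ⟩ ⟨P', K', φ'⟩ h
    simp only at h
    obtain rfl : P = P' := by rw [← φ.map_fst_relGraph, h, φ'.map_fst_relGraph]
    obtain rfl : K = K' := by rw [← φ.comap_inr_relGraph, h, φ'.comap_inr_relGraph]
    rw [AddMonoidHom.relGraph_injective h]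
  · intro H
    obtain ⟨φ, hφ⟩ := AddMonoidHom.exists_relGraph_eq H
    exact ⟨⟨_, _, φ⟩, hφ⟩

theorem AddSubgroup.card_eq_card_map_fst_mul_card_comap_inr (H : AddSubgroup (A × B)) :
    Nat.card H = Nat.card (H.map (AddMonoidHom.fst A B)) *
      Nat.card (H.comap (AddMonoidHom.inr A B)) := by
  let π : H →+ A := (AddMonoidHom.fst A B).comp H.subtype
  have hr : π.range = H.map (AddMonoidHom.fst A B) := by
    rw [AddMonoidHom.range_comp, AddSubgroup.range_subtype]
  have hk : π.ker ≃ H.comap (AddMonoidHom.inr A B) :=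
    { toFun := fun x => ⟨x.1.1.2, by
        have h1 : x.1.1.1 = 0 := x.2
        have h2 := x.1.2
        change ((0 : A), x.1.1.2) ∈ H
        rwa [← h1]⟩
      invFun := fun b => ⟨⟨(0, b.1), b.2⟩, rfl⟩
      left_inv := by
        rintro ⟨⟨⟨a, b⟩, h⟩, h'⟩
        obtain rfl : a = 0 := h'
        rfl
      right_inv := fun b => rfl }
  rw [← hr, ← AddSubgroup.index_ker, ← Nat.card_congr hk, mul_comm, AddSubgroup.card_mul_index]

/-- Summation over the subgroups of `A × B` of a function of their order, in Goursat's
coordinates. -/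
theorem AddSubgroup.sum_card_prod [Finite A] [Finite B] (f : ℕ → ℕ) :
    ∑ H : AddSubgroup (A × B), f (Nat.card H) =
      ∑ P : AddSubgroup A, ∑ K : AddSubgroup B,
        Nat.card (P →+ B ⧸ K) * f (Nat.card P * Nat.card K) := by
  have : ∀ (P : AddSubgroup A) (K : AddSubgroup B), Fintype (P →+ B ⧸ K) := fun P K =>
    haveI : Finite (P →+ B ⧸ K) := DFunLike.finite _
    Fintype.ofFinite _
  rw [← (Equiv.ofBijective _ AddMonoidHom.relGraph_bijective).sum_comp, Fintype.sum_sigma]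
  refine Finset.sum_congr rfl fun P _ => ?_
  rw [Fintype.sum_sigma]
  refine Finset.sum_congr rfl fun K _ => ?_
  rw [Nat.card_eq_fintype_card, ← smul_eq_mul, ← Finset.card_univ, ← Finset.sum_const]
  refine Finset.sum_congr rfl fun φ _ => ?_
  rw [Equiv.ofBijective_apply, AddSubgroup.card_eq_card_map_fst_mul_card_comap_inr,
    φ.map_fst_relGraph, φ.comap_inr_relGraph]

end Goursat

/-! ### Subgroups of a cyclic group of prime power order -/

theorem AddSubgroup.eq_ker_nsmul_card {C : Type*} [AddCommGroup C] [IsAddCyclic C] [Finite C]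
    (P : AddSubgroup C) : P = (nsmulAddMonoidHom (Nat.card P) : C →+ C).ker := by
  refine AddSubgroup.eq_of_le_of_card_ge (fun x hx => ?_) ?_
  · have := card_nsmul_eq_zero' (x := (⟨x, hx⟩ : P))
    exact congrArg Subtype.val this
  · rw [IsAddCyclic.card_nsmulAddMonoidHom_ker,
      Nat.gcd_eq_right P.card_addSubgroup_dvd_card]

/-- A cyclic group of order `p^n` has exactly one subgroup of order `p^m` for each `m ≤ n`, namely
the kernel of multiplication by `p^m`. -/
theorem AddSubgroup.sum_of_isAddCyclic {C : Type*} [AddCommGroup C] [IsAddCyclic C] [Finite C]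
    {p n : ℕ} (hp : p.Prime) (hC : Nat.card C = p ^ n) (f : AddSubgroup C → ℕ) (g : ℕ → ℕ)
    (hfg : ∀ (m : ℕ) (P : AddSubgroup C), Nat.card P = p ^ m → f P = g m) :
    ∑ P : AddSubgroup C, f P = ∑ m ∈ Finset.range (n + 1), g m := by
  have hcard : ∀ m ∈ Finset.range (n + 1),
      Nat.card (nsmulAddMonoidHom (p ^ m) : C →+ C).ker = p ^ m := fun m hm => by
    rw [IsAddCyclic.card_nsmulAddMonoidHom_ker, hC, Nat.gcd_eq_right]
    exact pow_dvd_pow p (Finset.mem_range_succ_iff.1 hm)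
  symm
  refine Finset.sum_bij (fun m _ => (nsmulAddMonoidHom (p ^ m) : C →+ C).ker)
    (fun _ _ => Finset.mem_univ _) ?_ ?_ ?_
  · intro m hm m' hm' h
    refine Nat.pow_right_injective hp.two_le ?_
    simp only
    rw [← hcard m hm, ← hcard m' hm', h]
  · intro P _
    have hd := P.card_addSubgroup_dvd_card
    rw [hC] at hd
    obtain ⟨m, hm, h⟩ := (Nat.dvd_prime_pow hp).1 hd
    refine ⟨m, Finset.mem_range_succ_iff.2 hm, ?_⟩
    rw [← h, ← P.eq_ker_nsmul_card]
  · intro m hm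
    exact (hfg m _ (hcard m hm)).symm

theorem ZMod.card_addMonoidHom (n : ℕ) (Q : Type*) [AddCommGroup Q] :
    Nat.card (ZMod n →+ Q) = Nat.card (nsmulAddMonoidHom n : Q →+ Q).ker := by
  rw [← Nat.card_congr (ZMod.lift n)]
  refine Nat.card_congr ((zmultiplesHom Q).symm.subtypeEquiv fun f => ?_)
  simp only [AddMonoidHom.mem_ker, nsmulAddMonoidHom_apply]
  change f n = 0 ↔ n • f 1 = 0
  rw [← map_nsmul, nsmul_one]

theorem IsAddCyclic.card_addMonoidHom (P Q : Type*) [AddCommGroup P] [IsAddCyclic P]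
    [AddCommGroup Q] :
    Nat.card (P →+ Q) = Nat.card (nsmulAddMonoidHom (Nat.card P) : Q →+ Q).ker := by
  rw [← ZMod.card_addMonoidHom]
  exact Nat.card_congr (zmodAddCyclicAddEquiv ‹_›).symm.addMonoidHomCongrLeftEquiv

/-! ### Summing the indices of the subgroups of a group of rank at most two -/

/-- The sum of `|(ℤ/p^b × ℤ/p^c) / K|` over all subgroups `K`, as a double sum over the exponents
of the two Goursat factors of `K`; the second exponent is replaced by its complement `c - l`. -/
def indexSum (p b c : ℕ) : ℕ :=
  ∑ m ∈ Finset.range (b + 1), ∑ l ∈ Finset.range (c + 1), p ^ (min m l + (b - m + l))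

theorem Nat.gcd_pow_pow_eq_pow_min (p a b : ℕ) : (p ^ a).gcd (p ^ b) = p ^ min a b := by
  rcases le_total a b with h | h
  · rw [min_eq_left h, Nat.gcd_eq_left (pow_dvd_pow p h)]
  · rw [min_eq_right h, Nat.gcd_eq_right (pow_dvd_pow p h)]

theorem sum_card_quotient_eq_indexSum {p : ℕ} [hp : Fact p.Prime] (b c : ℕ) :
    ∑ K : AddSubgroup (ZMod (p ^ b) × ZMod (p ^ c)),
      Nat.card ((ZMod (p ^ b) × ZMod (p ^ c)) ⧸ K) = indexSum p b c := by
  have hpos : 0 < p := hp.out.pos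
  have hq : ∀ K : AddSubgroup (ZMod (p ^ b) × ZMod (p ^ c)),
      Nat.card ((ZMod (p ^ b) × ZMod (p ^ c)) ⧸ K) = p ^ (b + c) / Nat.card K := fun K => by
    have h := K.card_eq_card_quotient_mul_card_addSubgroup
    rw [Nat.card_prod, Nat.card_zmod, Nat.card_zmod, ← pow_add] at h
    rw [h, Nat.mul_div_cancel _ Nat.card_pos]
  -- The index depends on the order only, so Goursat's coordinates apply.
  rw [Finset.sum_congr rfl fun K _ => hq K,
    AddSubgroup.sum_card_prod fun n => p ^ (b + c) / n]
  refine AddSubgroup.sum_of_isAddCyclic hp.out (Nat.card_zmod _) _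
    (fun m => ∑ l ∈ Finset.range (c + 1), p ^ (min m l + (b - m + l))) fun m P hP => ?_
  have hm : m ≤ b := by
    have := P.card_addSubgroup_dvd_card
    rw [hP, Nat.card_zmod] at this
    exact (Nat.pow_dvd_pow_iff_le_right hp.out.one_lt).1 this
  rw [← Finset.sum_range_reflect]
  refine AddSubgroup.sum_of_isAddCyclic hp.out (Nat.card_zmod _) _ _ fun l L hL => ?_
  have hLd := L.card_eq_card_quotient_mul_card_addSubgroup
  rw [hL, Nat.card_zmod] at hLd
  have hl : l ≤ c := (Nat.pow_dvd_pow_iff_le_right hp.out.one_lt).1 ⟨_, hLd.trans (mul_comm _ _)⟩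
  have hQ : Nat.card (ZMod (p ^ c) ⧸ L) = p ^ (c - l) := by
    refine Nat.eq_of_mul_eq_mul_right (pow_pos hpos l) ?_
    rw [← hLd, ← pow_add, Nat.sub_add_cancel hl]
  have : IsAddCyclic (ZMod (p ^ c) ⧸ L) :=
    isAddCyclic_of_surjective (QuotientAddGroup.mk' L) (QuotientAddGroup.mk'_surjective L)
  rw [IsAddCyclic.card_addMonoidHom, IsAddCyclic.card_nsmulAddMonoidHom_ker, hP, hL, hQ,
    Nat.gcd_pow_pow_eq_pow_min, ← pow_add, Nat.pow_div (by omega) hpos, ← pow_add]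
  congr 1
  omega

theorem indexSum_succ_left (p b c : ℕ) (h : c ≤ b + 1) :
    indexSum p (b + 1) c = p * indexSum p b c + ∑ l ∈ Finset.range (c + 1), p ^ (2 * l) := by
  unfold indexSum
  rw [Finset.sum_range_succ, Finset.mul_sum]
  congr 1
  · refine Finset.sum_congr rfl fun m hm => ?_
    rw [Finset.mul_sum]
    refine Finset.sum_congr rfl fun l _ => ?_
    rw [← pow_succ']
    congr 1
    have := Finset.mem_range.1 hm
    omega
  · refine Finset.sum_congr rfl fun l hl => ?_
    congr 1
    have := Finset.mem_range.1 hl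
    omega

theorem indexSum_succ_right (p c : ℕ) :
    indexSum p (c + 1) (c + 1) = indexSum p (c + 1) c + (c + 2) * p ^ (2 * c + 2) := by
  unfold indexSum
  simp_rw [Finset.sum_range_succ _ (c + 1), Finset.sum_add_distrib]
  have : ∀ m ∈ Finset.range (c + 1 + 1), p ^ (min m (c + 1) + (c + 1 - m + (c + 1))) =
      p ^ (2 * c + 2) := fun m hm => by
    congr 1
    have := Finset.mem_range.1 hm
    omega
  have h := Finset.sum_congr rfl this
  rw [Finset.sum_const, Finset.card_range, Finset.sum_range_succ, smul_eq_mul] at h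
  rw [← h]
  ring

/-- The induction runs from `(c, c)` along `b`, and from `(c, c)` through `(c + 1, c)` to
`(c + 1, c + 1)`. -/
theorem indexSum_mul (p c : ℕ) {b : ℕ} (h : c ≤ b) :
    (indexSum p b c : ℚ) * (((p : ℚ) ^ 2 - 1) * ((p : ℚ) - 1)) =
      ((c : ℚ) + 1) * (p : ℚ) ^ (b + c + 1) * ((p : ℚ) ^ 2 - 1) - (p : ℚ) ^ (2 * c + 2) + 1 := by
  have hgeom : ∀ c : ℕ, (∑ l ∈ Finset.range (c + 1), (p : ℚ) ^ (2 * l)) * ((p : ℚ) ^ 2 - 1) =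
      (p : ℚ) ^ (2 * c + 2) - 1 := fun c => by
    simp_rw [pow_mul]
    rw [geom_sum_mul, ← pow_mul, mul_add, mul_one]
  have step : ∀ b c : ℕ, c ≤ b + 1 →
      (indexSum p b c : ℚ) * (((p : ℚ) ^ 2 - 1) * ((p : ℚ) - 1)) = ((c : ℚ) + 1) *
        (p : ℚ) ^ (b + c + 1) * ((p : ℚ) ^ 2 - 1) - (p : ℚ) ^ (2 * c + 2) + 1 →
      (indexSum p (b + 1) c : ℚ) * (((p : ℚ) ^ 2 - 1) * ((p : ℚ) - 1)) = ((c : ℚ) + 1) *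
        (p : ℚ) ^ (b + 1 + c + 1) * ((p : ℚ) ^ 2 - 1) - (p : ℚ) ^ (2 * c + 2) + 1 := by
    intro b c hbc ih
    rw [indexSum_succ_left p b c hbc]
    push_cast
    linear_combination (p : ℚ) * ih + ((p : ℚ) - 1) * hgeom c
  induction b, h using Nat.le_induction with
  | base =>
    induction c with
    | zero => simp [indexSum]; ring
    | succ c ih =>
      have h := step c c (Nat.le_succ c) ih
      rw [indexSum_succ_right]
      push_cast
      linear_combination h
  | succ b hb ih => exact step b c (hb.trans (Nat.le_succ b)) ih

/-! ### Counting subgroups of a given exponent -/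

/-- The subgroups of `ℤ/p^(a+1) × B` whose projection to the first factor is not surjective are as
many as the subgroups of `ℤ/p^a × B`. Those with surjective projection and intersection `K` with
`B` correspond to homomorphisms `ℤ/p^(a+1) → B ⧸ K`, hence to elements of `B ⧸ K`, because
`p^(a+1)` kills `B`. -/
theorem card_addSubgroup_zmod_succ_prod {p a : ℕ} [hp : Fact p.Prime] {B : Type*}
    [AddCommGroup B] [Finite B] (hB : ∀ x : B, p ^ (a + 1) • x = 0) :
    Nat.card (AddSubgroup (ZMod (p ^ (a + 1)) × B)) =
      Nat.card (AddSubgroup (ZMod (p ^ a) × B)) + ∑ K : AddSubgroup B, Nat.card (B ⧸ K) := by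
  have key : ∀ n, Nat.card (AddSubgroup (ZMod (p ^ n) × B)) = ∑ m ∈ Finset.range (n + 1),
      ∑ K : AddSubgroup B, Nat.card (nsmulAddMonoidHom (p ^ m) : B ⧸ K →+ B ⧸ K).ker := by
    intro n
    have h := AddSubgroup.sum_card_prod (A := ZMod (p ^ n)) (B := B) fun _ => 1
    rw [Finset.sum_const, Finset.card_univ, smul_eq_mul, mul_one,
      ← Nat.card_eq_fintype_card] at h
    rw [h]
    refine AddSubgroup.sum_of_isAddCyclic hp.out (Nat.card_zmod _) _ _ fun m P hP => ?_
    simp_rw [IsAddCyclic.card_addMonoidHom, hP, mul_one]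
  rw [key, key, Finset.sum_range_succ]
  congr 1
  refine Finset.sum_congr rfl fun K _ => ?_
  have : (nsmulAddMonoidHom (p ^ (a + 1)) : B ⧸ K →+ B ⧸ K).ker = ⊤ := by
    refine (AddSubgroup.eq_top_iff' _).2 fun x => ?_
    obtain ⟨b, rfl⟩ := QuotientAddGroup.mk_surjective x
    rw [AddMonoidHom.mem_ker, nsmulAddMonoidHom_apply, ← QuotientAddGroup.mk_nsmul, hB,
      QuotientAddGroup.mk_zero]
  rw [this, AddSubgroup.card_top]

/-- The number of subgroups of `ℤ/p^a × ℤ/p^b × ℤ/p^c`. -/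
noncomputable def numSubgroups (p a b c : ℕ) : ℕ :=
  Nat.card (AddSubgroup (ZMod (p ^ a) × ZMod (p ^ b) × ZMod (p ^ c)))

theorem numSubgroups_left_comm (p a b c : ℕ) : numSubgroups p a b c = numSubgroups p b a c :=
  Nat.card_congr (AddEquiv.mapAddSubgroup
    (AddEquiv.prodAssoc.symm.trans
      ((AddEquiv.prodComm.prodCongr (AddEquiv.refl _)).trans AddEquiv.prodAssoc))).toEquiv

theorem numSubgroups_right_comm (p a b c : ℕ) : numSubgroups p a b c = numSubgroups p a c b :=
  Nat.card_congr (AddEquiv.mapAddSubgroup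
    ((AddEquiv.refl _).prodCongr AddEquiv.prodComm)).toEquiv

/-- The condition that `a + 1` is at least `b` and `c` is what makes the increment independent of
`a`. -/
theorem numSubgroups_succ {p a b c : ℕ} [Fact p.Prime] (hb : b ≤ a + 1) (hc : c ≤ a + 1) :
    numSubgroups p (a + 1) b c = numSubgroups p a b c + indexSum p b c := by
  rw [numSubgroups, card_addSubgroup_zmod_succ_prod, sum_card_quotient_eq_indexSum, numSubgroups]
  have hz : ∀ {n : ℕ}, n ≤ a + 1 → ∀ x : ZMod (p ^ n), p ^ (a + 1) • x = 0 := fun h x => by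
    rw [nsmul_eq_mul, (ZMod.natCast_eq_zero_iff _ _).2 (pow_dvd_pow p h), zero_mul]
  rintro ⟨x, y⟩
  exact Prod.ext (hz hb x) (hz hc y)

/-- The subgroups of exponent dividing `p^i` are the subgroups of the `p^i`-torsion of the whole
group, which is again a product of three cyclic groups. -/
theorem card_addSubgroup_exponent_dvd {p : ℕ} [hp : Fact p.Prime] (l₁ l₂ l₃ i : ℕ) :
    {H : AddSubgroup (ZMod (p ^ l₁) × ZMod (p ^ l₂) × ZMod (p ^ l₃)) |
      AddMonoid.exponent H ∣ p ^ i}.ncard = numSubgroups p (min l₁ i) (min l₂ i) (min l₃ i) := by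
  let D : ∀ l, AddSubgroup (ZMod (p ^ l)) := fun l => (nsmulAddMonoidHom (p ^ i)).ker
  have hD : ∀ l, Nat.card (D l) = Nat.card (ZMod (p ^ min l i)) := fun l => by
    rw [IsAddCyclic.card_nsmulAddMonoidHom_ker, Nat.card_zmod, Nat.card_zmod,
      Nat.gcd_pow_pow_eq_pow_min]
  let e : ∀ l, D l ≃+ ZMod (p ^ min l i) := fun l => addEquivOfAddCyclicCardEq (hD l)
  let T := (D l₁).prod ((D l₂).prod (D l₃))
  have hT : ∀ H : AddSubgroup (ZMod (p ^ l₁) × ZMod (p ^ l₂) × ZMod (p ^ l₃)),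
      AddMonoid.exponent H ∣ p ^ i ↔ H ≤ T := by
    intro H
    rw [AddMonoid.exponent_dvd_iff_forall_nsmul_eq_zero, Subtype.forall]
    refine forall₂_congr fun x hx => ?_
    rw [Subtype.ext_iff]
    change p ^ i • x = 0 ↔ x ∈ T
    simp only [Prod.ext_iff, AddSubgroup.mem_prod, T, D, AddMonoidHom.mem_ker,
      nsmulAddMonoidHom_apply, Prod.fst_zero, Prod.snd_zero, Prod.smul_fst, Prod.smul_snd]
  simp_rw [hT]
  rw [← Nat.card_coe_set_eq, numSubgroups]
  exact Nat.card_congr ((AddSubgroup.MapSubtype.orderIso T).symm.toEquiv.trans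
    (AddEquiv.mapAddSubgroup ((AddSubgroup.prodEquiv _ _).trans
      ((e l₁).prodCongr ((AddSubgroup.prodEquiv _ _).trans ((e l₂).prodCongr (e l₃)))))).toEquiv)

/-- Having exponent exactly `p^(j+1)` means having exponent dividing `p^(j+1)` but not `p^j`. -/
theorem ncard_subgroupsOfExponent_add {p : ℕ} [hp : Fact p.Prime] (l₁ l₂ l₃ j : ℕ) :
    (subgroupsOfExponent (ZMod (p ^ l₁) × ZMod (p ^ l₂) × ZMod (p ^ l₃)) (p ^ (j + 1))).ncard +
      numSubgroups p (min l₁ j) (min l₂ j) (min l₃ j) =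
      numSubgroups p (min l₁ (j + 1)) (min l₂ (j + 1)) (min l₃ (j + 1)) := by
  rw [← card_addSubgroup_exponent_dvd, ← card_addSubgroup_exponent_dvd,
    ← Set.ncard_union_eq _ (Set.toFinite _) (Set.toFinite _)]
  · congr 1
    ext H
    change AddMonoid.exponent H = p ^ (j + 1) ∨ AddMonoid.exponent H ∣ p ^ j ↔
      AddMonoid.exponent H ∣ p ^ (j + 1)
    rw [Nat.dvd_prime_pow hp.out, Nat.dvd_prime_pow hp.out]
    constructor
    · rintro (h | ⟨m, hm, h⟩)
      · exact ⟨_, le_rfl, h⟩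
      · exact ⟨m, hm.trans (Nat.le_succ j), h⟩
    · rintro ⟨m, hm, h⟩
      rcases Nat.le_succ_iff.1 hm with hm | rfl
      · exact Or.inr ⟨m, hm, h⟩
      · exact Or.inl h
  · refine Set.disjoint_left.2 fun H h h' => ?_
    change AddMonoid.exponent H = _ at h
    change AddMonoid.exponent H ∣ _ at h'
    rw [h, Nat.pow_dvd_pow_iff_le_right hp.out.one_lt] at h'
    exact absurd h' (Nat.not_succ_le_self j)

theorem ncard_subgroupsOfExponent_of_lt {p : ℕ} [Fact p.Prime] {l₁ l₂ l₃ j : ℕ}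
    (h₂₃ : l₃ ≤ l₂) (h₂ : l₂ ≤ j) (h₁ : j < l₁) :
    (subgroupsOfExponent (ZMod (p ^ l₁) × ZMod (p ^ l₂) × ZMod (p ^ l₃)) (p ^ (j + 1))).ncard =
      indexSum p l₂ l₃ := by
  have h := ncard_subgroupsOfExponent_add (p := p) l₁ l₂ l₃ j
  rw [min_eq_right h₁.le, min_eq_right (Nat.succ_le_of_lt h₁), min_eq_left h₂,
    min_eq_left (h₂.trans j.le_succ), min_eq_left (h₂₃.trans h₂),
    min_eq_left (h₂₃.trans (h₂.trans j.le_succ)),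
    numSubgroups_succ (h₂.trans j.le_succ) (h₂₃.trans (h₂.trans j.le_succ))] at h
  omega

/-- The parameters are lowered from `(j+1, j+1, l₃)` to `(j, j, l₃)` one at a time. Each time the
coordinate to be lowered is a largest one and is moved to the front, so that
`numSubgroups_succ` applies. -/
theorem ncard_subgroupsOfExponent_of_lt_of_le {p : ℕ} [Fact p.Prime] {l₁ l₂ l₃ j : ℕ}
    (h₁₂ : l₂ ≤ l₁) (h₃ : l₃ ≤ j) (h₂ : j < l₂) :
    (subgroupsOfExponent (ZMod (p ^ l₁) × ZMod (p ^ l₂) × ZMod (p ^ l₃)) (p ^ (j + 1))).ncard =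
      indexSum p (j + 1) l₃ + indexSum p j l₃ := by
  have h := ncard_subgroupsOfExponent_add (p := p) l₁ l₂ l₃ j
  rw [min_eq_right (h₂.le.trans h₁₂), min_eq_right (Nat.succ_le_of_lt (h₂.trans_le h₁₂)),
    min_eq_right h₂.le,
    min_eq_right (Nat.succ_le_of_lt h₂), min_eq_left h₃, min_eq_left (h₃.trans j.le_succ),
    numSubgroups_succ le_rfl (h₃.trans j.le_succ), numSubgroups_left_comm p j (j + 1) l₃,
    numSubgroups_succ j.le_succ (h₃.trans j.le_succ)] at h
  omega

theorem ncard_subgroupsOfExponent_of_le {p : ℕ} [Fact p.Prime] {l₁ l₂ l₃ j : ℕ}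
    (h₁₂ : l₂ ≤ l₁) (h₂₃ : l₃ ≤ l₂) (h₃ : j < l₃) :
    (subgroupsOfExponent (ZMod (p ^ l₁) × ZMod (p ^ l₂) × ZMod (p ^ l₃)) (p ^ (j + 1))).ncard =
      indexSum p (j + 1) (j + 1) + indexSum p (j + 1) j + indexSum p j j := by
  have h := ncard_subgroupsOfExponent_add (p := p) l₁ l₂ l₃ j
  have h₂ := h₃.trans_le h₂₃
  have h₁ := h₂.trans_le h₁₂
  rw [min_eq_right h₁.le, min_eq_right (Nat.succ_le_of_lt h₁), min_eq_right h₂.le,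
    min_eq_right (Nat.succ_le_of_lt h₂), min_eq_right h₃.le, min_eq_right (Nat.succ_le_of_lt h₃),
    numSubgroups_succ le_rfl le_rfl, numSubgroups_left_comm p j (j + 1) (j + 1),
    numSubgroups_right_comm p (j + 1) j (j + 1), numSubgroups_succ le_rfl j.le_succ,
    numSubgroups_left_comm p j (j + 1) j, numSubgroups_succ j.le_succ j.le_succ] at h
  omega

theorem mainTheorem3 (p : ℕ) (hp : p.Prime) (l₁ l₂ l₃ : ℕ)
    (h₁₂ : l₂ ≤ l₁) (h₂₃ : l₃ ≤ l₂) (h₃ : 1 ≤ l₃) (i : ℕ) :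
    (1 ≤ i → i ≤ l₃ →
      ((subgroupsOfExponent
          (ZMod (p ^ l₁) × ZMod (p ^ l₂) × ZMod (p ^ l₃)) (p ^ i)).ncard : ℚ) =
        ((p : ℚ) ^ (2 * i - 1) *
            (((i : ℚ) + 1) * (p : ℚ) ^ 4 + ((i : ℚ) - 1) * (p : ℚ) ^ 3 - (p : ℚ) ^ 2
              - ((i : ℚ) + 2) * (p : ℚ) - (i : ℚ)) + 3) /
          (((p : ℚ) ^ 2 - 1) * ((p : ℚ) - 1))) ∧
    (l₃ < i → i ≤ l₂ →
      ((subgroupsOfExponent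
          (ZMod (p ^ l₁) × ZMod (p ^ l₂) × ZMod (p ^ l₃)) (p ^ i)).ncard : ℚ) =
        (((l₃ : ℚ) + 1) * (p : ℚ) ^ (l₃ + i) * ((p : ℚ) ^ 2 - 1) * ((p : ℚ) + 1)
            - 2 * (p : ℚ) ^ (2 * l₃ + 2) + 2) /
          (((p : ℚ) ^ 2 - 1) * ((p : ℚ) - 1))) ∧
    (l₂ < i → i ≤ l₁ →
      ((subgroupsOfExponent
          (ZMod (p ^ l₁) × ZMod (p ^ l₂) × ZMod (p ^ l₃)) (p ^ i)).ncard : ℚ) =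
        (((l₃ : ℚ) + 1) * (p : ℚ) ^ (l₂ + l₃ + 1) * ((p : ℚ) ^ 2 - 1)
            - (p : ℚ) ^ (2 * l₃ + 2) + 1) /
          (((p : ℚ) ^ 2 - 1) * ((p : ℚ) - 1))) := by
  have : Fact p.Prime := ⟨hp⟩
  have hp1 : (1 : ℚ) < p := by exact_mod_cast hp.one_lt
  have hd : ((p : ℚ) ^ 2 - 1) * ((p : ℚ) - 1) ≠ 0 :=
    (mul_pos (sub_pos.2 (one_lt_pow₀ hp1 two_ne_zero)) (sub_pos.2 hp1)).ne'
  refine ⟨fun hi hi' => ?_, fun hi hi' => ?_, fun hi hi' => ?_⟩ <;>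
    rw [eq_div_iff hd] <;>
    obtain ⟨j, rfl⟩ := Nat.exists_eq_add_of_lt (Nat.zero_lt_of_lt hi) <;>
    rw [zero_add] at *
  · rw [ncard_subgroupsOfExponent_of_le h₁₂ h₂₃ hi', show 2 * (j + 1) - 1 = 2 * j + 1 by omega]
    push_cast
    have e₁ := indexSum_mul p (j + 1) le_rfl
    push_cast at e₁
    linear_combination e₁ + indexSum_mul p j (b := j + 1) j.le_succ + indexSum_mul p j le_rfl
  · rw [ncard_subgroupsOfExponent_of_lt_of_le h₁₂ (Nat.lt_succ_iff.1 hi) hi']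
    push_cast
    linear_combination indexSum_mul p l₃ hi.le + indexSum_mul p l₃ (Nat.lt_succ_iff.1 hi)
  · rw [ncard_subgroupsOfExponent_of_lt h₂₃ (Nat.lt_succ_iff.1 hi) hi']
    exact indexSum_mul p l₃ h₂₃
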